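/- Let $\Theta\in(0,2\pi)$, let $$\Omega=\{(x,y)\in\mathbb R^2:\ 0<x^2+y^2<1,\ \text{the polar angle of }(x,y)\text{ lies in }(0,\Theta)\}$$ be the open circular sector of angle $\Theta$, let $Q=(0,1)\times(0,\Theta)$ and $F(r,\theta)=r(\cos\theta,\sin\theta)$. All functions are real-valued. For a positive weight $w$ on $Q$ let $L^2_w(Q)$ be the space of (a.e. classes of) measurable $v$ on $Q$ with $\|v\|_{L^2_w(Q)}^2=\iint_Q v^2\,w\,dr\,d\theta<\infty$, and let $\tilde H^1(Q)$ be the space of all $u\in L^2_r(Q)$ whose weak derivatives on $Q$ satisfy $\partial_r u\in L^2_r(Q)$ and $\partial_\theta u\in L^2_{1/r}(Q)$, with the norm $$\|u\|_{\tilde H^1(Q)}^2=\iint_Q\Big(r\,u^2+r\,(\partial_r u)^2+\tfrac1r(\partial_\theta u)^2\Big)\,dr\,d\theta .$$ Let $H^1(\Omega)$ be the usual Sobolev space with the norm $\|\hat u\|_{H^1(\Omega)}^2=\int_\Omega(\hat u^2+|\nabla\hat u|^2)$. Then $\Phi:\hat u\mapsto\hat u\circ F$ is a well-defined linear map (on a.e.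 classes) from $L^2(\Omega)$ to $L^2_r(Q)$, and it restricts to a linear isometry from $H^1(\Omega)$ onto $\tilde H^1(Q)$. -/

import Mathlib

open MeasureTheory Set TopologicalSpace
open scoped ENNReal Distributions

namespace PolarSobolev

/-! ### Weak partial derivatives -/

/-- `g` is the weak derivative of `f` in the direction `e` on the open set `U ⊆ ℝ²`: both functions
are locally integrable on `U` and `∫_U f ∂ₑφ = - ∫_U g φ` for all smooth `φ` with compact support
in `U`. -/
def HasWeakPartial (U : Opens (ℝ × ℝ)) (e : ℝ × ℝ) (f g : ℝ × ℝ → ℝ) : Prop :=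
  LocallyIntegrableOn f U ∧ LocallyIntegrableOn g U ∧
    ∀ φ : 𝓓(U, ℝ), ∫ p in U, f p * fderiv ℝ φ p e = -∫ p in U, g p * φ p

section WeakPartial

variable {U : Opens (ℝ × ℝ)} {e : ℝ × ℝ}

theorem integrableOn_mul_of_compact {f ψ : ℝ × ℝ → ℝ} (hf : LocallyIntegrableOn f U)
    (hψ : Continuous ψ) (hc : HasCompactSupport ψ) (hs : tsupport ψ ⊆ U) :
    IntegrableOn (fun p => f p * ψ p) U := by
  have h1 : IntegrableOn (fun p => f p * ψ p) (tsupport ψ) :=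
    (hf.integrableOn_compact_subset hs hc).mul_continuousOn hψ.continuousOn hc
  have h2 : Integrable (fun p => f p * ψ p) := by
    rwa [← integrableOn_iff_integrable_of_support_subset]
    intro p hp
    exact subset_tsupport ψ (fun h => hp (by simp [h]))
  exact h2.integrableOn

theorem integrableOn_mul_test {f : ℝ × ℝ → ℝ} (hf : LocallyIntegrableOn f U) (φ : 𝓓(U, ℝ)) :
    IntegrableOn (fun p => f p * φ p) U :=
  integrableOn_mul_of_compact hf φ.continuous φ.hasCompactSupport φ.tsupport_subset

theorem integrableOn_mul_fderiv {f : ℝ × ℝ → ℝ} (hf : LocallyIntegrableOn f U) (φ : 𝓓(U, ℝ))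
    (e : ℝ × ℝ) : IntegrableOn (fun p => f p * fderiv ℝ φ p e) U :=
  integrableOn_mul_of_compact hf
    ((φ.contDiff.continuous_fderiv (by simp)).clm_apply continuous_const)
    (φ.hasCompactSupport.fderiv_apply ℝ e)
    ((tsupport_fderiv_apply_subset ℝ e).trans φ.tsupport_subset)

theorem HasWeakPartial.congr {f f' g g' : ℝ × ℝ → ℝ} (h : HasWeakPartial U e f g)
    (hf : f =ᵐ[volume.restrict (U : Set (ℝ × ℝ))] f')
    (hg : g =ᵐ[volume.restrict (U : Set (ℝ × ℝ))] g') : HasWeakPartial U e f' g' := by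
  obtain ⟨h1, h2, h3⟩ := h
  have key : ∀ {k k' : ℝ × ℝ → ℝ}, k =ᵐ[volume.restrict (U : Set (ℝ × ℝ))] k' →
      LocallyIntegrableOn k U → LocallyIntegrableOn k' U := by
    intro k k' hk h
    rw [locallyIntegrableOn_iff U.isOpen.isLocallyClosed] at h ⊢
    intro K hKU hK
    exact (h K hKU hK).congr (ae_restrict_of_ae_restrict_of_subset hKU hk)
  refine ⟨key hf h1, key hg h2, fun φ => ?_⟩
  have e1 : ∫ p in U, f' p * fderiv ℝ φ p e = ∫ p in U, f p * fderiv ℝ φ p e :=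
    integral_congr_ae (by filter_upwards [hf] with p hp; rw [hp])
  have e2 : ∫ p in U, g' p * φ p = ∫ p in U, g p * φ p :=
    integral_congr_ae (by filter_upwards [hg] with p hp; rw [hp])
  rw [e1, e2, h3 φ]

theorem HasWeakPartial.add {f f' g g' : ℝ × ℝ → ℝ} (h : HasWeakPartial U e f g)
    (h' : HasWeakPartial U e f' g') : HasWeakPartial U e (f + f') (g + g') := by
  refine ⟨h.1.add h'.1, h.2.1.add h'.2.1, fun φ => ?_⟩
  simp only [Pi.add_apply, add_mul]
  rw [integral_add (integrableOn_mul_fderiv h.1 φ e) (integrableOn_mul_fderiv h'.1 φ e),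
    integral_add (integrableOn_mul_test h.2.1 φ) (integrableOn_mul_test h'.2.1 φ),
    h.2.2 φ, h'.2.2 φ]
  ring

theorem HasWeakPartial.const_smul {f g : ℝ × ℝ → ℝ} (c : ℝ) (h : HasWeakPartial U e f g) :
    HasWeakPartial U e (c • f) (c • g) := by
  refine ⟨h.1.smul c, h.2.1.smul c, fun φ => ?_⟩
  simp only [Pi.smul_apply, smul_eq_mul, mul_assoc]
  rw [integral_const_mul, integral_const_mul, h.2.2 φ]
  ring

theorem hasWeakPartial_zero : HasWeakPartial U e 0 0 := by
  refine ⟨?_, ?_, fun φ => by simp⟩ <;> exact (locallyIntegrable_zero).locallyIntegrableOn _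

theorem HasWeakPartial.unique {f g g' : ℝ × ℝ → ℝ} (h : HasWeakPartial U e f g)
    (h' : HasWeakPartial U e f g') : g =ᵐ[volume.restrict (U : Set (ℝ × ℝ))] g' := by
  have := U.isOpen.ae_eq_zero_of_integral_contDiff_smul_eq_zero (μ := volume)
    (f := g - g') (h.2.1.sub h'.2.1) ?_
  · rw [Filter.EventuallyEq, ae_restrict_iff' U.isOpen.measurableSet]
    filter_upwards [this] with p hp hpU
    exact sub_eq_zero.1 (hp hpU)
  · intro ψ hψ hc hs
    let φ : 𝓓(U, ℝ) := ⟨ψ, hψ, hc, hs⟩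
    have e1 : ∫ p in U, g p * ψ p = ∫ p in U, g' p * ψ p := by
      have := (h.2.2 φ).symm.trans (h'.2.2 φ)
      exact neg_injective this
    have i1 : IntegrableOn (fun p => g p * ψ p) U := integrableOn_mul_test h.2.1 φ
    have i2 : IntegrableOn (fun p => g' p * ψ p) U := integrableOn_mul_test h'.2.1 φ
    have e2 : ∫ p in U, (g p * ψ p - g' p * ψ p) = 0 := by
      rw [integral_sub i1 i2, e1, sub_self]
    rw [setIntegral_eq_integral_of_forall_compl_eq_zero] at e2
    · rw [← e2]
      congr 1
      ext p
      simp only [Pi.sub_apply, smul_eq_mul]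
      ring
    · intro p hp
      have : ψ p = 0 := image_eq_zero_of_notMem_tsupport (fun h => hp (hs h))
      simp [this]

end WeakPartial

/-! ### Weighted Lebesgue and Sobolev spaces -/

/-- `μ` has the same null sets as Lebesgue measure on `U`, so that `μ`-a.e. classes of functions
are the same as Lebesgue-a.e. classes of functions on `U`. -/
class SameNullSets (U : Opens (ℝ × ℝ)) (μ : Measure (ℝ × ℝ)) : Prop where
  ac : μ ≪ volume.restrict (U : Set (ℝ × ℝ))
  ca : volume.restrict (U : Set (ℝ × ℝ)) ≪ μ

instance instSameNullSetsVolume (U : Opens (ℝ × ℝ)) :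
    SameNullSets U (volume.restrict (U : Set (ℝ × ℝ))) :=
  ⟨Measure.AbsolutelyContinuous.rfl, Measure.AbsolutelyContinuous.rfl⟩

/-- The measure `w dx` on `U`. The weighted Lebesgue space `L²_w(U)` is
`Lp ℝ 2 (weightedMeasure U w)`. -/
noncomputable def weightedMeasure (U : Opens (ℝ × ℝ)) (w : ℝ × ℝ → ℝ) : Measure (ℝ × ℝ) :=
  (volume.restrict (U : Set (ℝ × ℝ))).withDensity fun p => ENNReal.ofReal (w p)

theorem sameNullSets_weightedMeasure {U : Opens (ℝ × ℝ)} {w : ℝ × ℝ → ℝ} (hw : Measurable w)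
    (hpos : ∀ p ∈ U, 0 < w p) : SameNullSets U (weightedMeasure U w) where
  ac := withDensity_absolutelyContinuous _ _
  ca := by
    refine withDensity_absolutelyContinuous' hw.ennreal_ofReal.aemeasurable ?_
    filter_upwards [ae_restrict_mem U.isOpen.measurableSet] with p hp
    simpa using hpos p hp

section Weighted

variable (U : Opens (ℝ × ℝ)) (μ₀ μ₁ μ₂ : Measure (ℝ × ℝ))
  [SameNullSets U μ₀] [SameNullSets U μ₁] [SameNullSets U μ₂]

/-- The functions in `L²(μ)` that have a weak derivative in the direction `e` on `U`
belonging to `L²(ν)`. -/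
def weakSubmodule (μ ν : Measure (ℝ × ℝ)) [SameNullSets U μ] [SameNullSets U ν] (e : ℝ × ℝ) :
    Submodule ℝ (Lp ℝ 2 μ) where
  carrier := {u | ∃ g : Lp ℝ 2 ν, HasWeakPartial U e u g}
  add_mem' := by
    rintro u v ⟨g, hg⟩ ⟨k, hk⟩
    exact ⟨g + k, (hg.add hk).congr (SameNullSets.ca.ae_eq (Lp.coeFn_add u v).symm)
      (SameNullSets.ca.ae_eq (Lp.coeFn_add g k).symm)⟩
  zero_mem' := ⟨0, hasWeakPartial_zero.congr (SameNullSets.ca.ae_eq (Lp.coeFn_zero ℝ 2 μ).symm)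
      (SameNullSets.ca.ae_eq (Lp.coeFn_zero ℝ 2 ν).symm)⟩
  smul_mem' := by
    rintro c u ⟨g, hg⟩
    exact ⟨c • g, (hg.const_smul c).congr (SameNullSets.ca.ae_eq (Lp.coeFn_smul c u).symm)
      (SameNullSets.ca.ae_eq (Lp.coeFn_smul c g).symm)⟩

/-- The weak derivative in the direction `e`, as a linear map into `L²(ν)`. -/
noncomputable def weakPartial (μ ν : Measure (ℝ × ℝ)) [SameNullSets U μ] [SameNullSets U ν]
    (e : ℝ × ℝ) : weakSubmodule U μ ν e →ₗ[ℝ] Lp ℝ 2 ν where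
  toFun u := u.2.choose
  map_add' u v := by
    have h := (u.2.choose_spec.add v.2.choose_spec).congr
      (SameNullSets.ca.ae_eq (Lp.coeFn_add u.1 v.1).symm)
      (SameNullSets.ca.ae_eq (Lp.coeFn_add u.2.choose v.2.choose).symm)
    exact Lp.ext (SameNullSets.ac.ae_eq ((u + v).2.choose_spec.unique h))
  map_smul' c u := by
    have h := (u.2.choose_spec.const_smul c).congr
      (SameNullSets.ca.ae_eq (Lp.coeFn_smul c u.1).symm)
      (SameNullSets.ca.ae_eq (Lp.coeFn_smul c u.2.choose).symm)
    exact Lp.ext (SameNullSets.ac.ae_eq ((c • u).2.choose_spec.unique h))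

/-- The space of all `u ∈ L²(μ₀)` whose weak partial derivatives on `U` satisfy `∂₁u ∈ L²(μ₁)` and
`∂₂u ∈ L²(μ₂)`. Its norm is the one defined below, not the one of `L²(μ₀)`. -/
def WSobolev : Type :=
  ↥(weakSubmodule U μ₀ μ₁ (1, 0) ⊓ weakSubmodule U μ₀ μ₂ (0, 1))

noncomputable instance instAddCommGroupWSobolev : AddCommGroup (WSobolev U μ₀ μ₁ μ₂) :=
  inferInstanceAs
    (AddCommGroup ↥(weakSubmodule U μ₀ μ₁ (1, 0) ⊓ weakSubmodule U μ₀ μ₂ (0, 1)))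

noncomputable instance instModuleWSobolev : Module ℝ (WSobolev U μ₀ μ₁ μ₂) :=
  inferInstanceAs
    (Module ℝ ↥(weakSubmodule U μ₀ μ₁ (1, 0) ⊓ weakSubmodule U μ₀ μ₂ (0, 1)))

variable {U μ₀ μ₁ μ₂}

/-- The inclusion into `L²(μ₀)`. -/
noncomputable def WSobolev.toL2 : WSobolev U μ₀ μ₁ μ₂ →ₗ[ℝ] Lp ℝ 2 μ₀ :=
  Submodule.subtype (weakSubmodule U μ₀ μ₁ (1, 0) ⊓ weakSubmodule U μ₀ μ₂ (0, 1))

/-- The weak partial derivative `∂₁u`. -/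
noncomputable def WSobolev.d₁ : WSobolev U μ₀ μ₁ μ₂ →ₗ[ℝ] Lp ℝ 2 μ₁ :=
  weakPartial U μ₀ μ₁ (1, 0) ∘ₗ Submodule.inclusion inf_le_left

/-- The weak partial derivative `∂₂u`. -/
noncomputable def WSobolev.d₂ : WSobolev U μ₀ μ₁ μ₂ →ₗ[ℝ] Lp ℝ 2 μ₂ :=
  weakPartial U μ₀ μ₂ (0, 1) ∘ₗ Submodule.inclusion inf_le_right

/-- The inner product `(u, v)_{L²(μ₀)} + (∂₁u, ∂₁v)_{L²(μ₁)} + (∂₂u, ∂₂v)_{L²(μ₂)}`. -/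
@[reducible]
noncomputable def WSobolev.core : InnerProductSpace.Core ℝ (WSobolev U μ₀ μ₁ μ₂) where
  inner u v := inner ℝ u.toL2 v.toL2 + inner ℝ u.d₁ v.d₁ + inner ℝ u.d₂ v.d₂
  conj_inner_symm u v := by
    simp only [conj_trivial, real_inner_comm]
  re_inner_nonneg u := by
    have h0 := real_inner_self_nonneg (x := u.toL2)
    have h1 := real_inner_self_nonneg (x := u.d₁)
    have h2 := real_inner_self_nonneg (x := u.d₂)
    simp only [RCLike.re_to_real]
    linarith
  add_left u v w := by
    simp only [map_add, inner_add_left]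
    ring
  smul_left u v c := by
    simp only [map_smul, real_inner_smul_left, conj_trivial]
    ring
  definite u h := by
    have h0 := real_inner_self_nonneg (x := u.toL2)
    have h1 := real_inner_self_nonneg (x := u.d₁)
    have h2 := real_inner_self_nonneg (x := u.d₂)
    have h3 : inner ℝ u.toL2 u.toL2 = 0 := by linarith
    exact Subtype.ext (inner_self_eq_zero.1 h3)

noncomputable instance instNormedAddCommGroupWSobolev :
    NormedAddCommGroup (WSobolev U μ₀ μ₁ μ₂) :=
  WSobolev.core.toNormedAddCommGroup

noncomputable instance instInnerProductSpaceWSobolev :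
    InnerProductSpace ℝ (WSobolev U μ₀ μ₁ μ₂) :=
  InnerProductSpace.ofCore WSobolev.core.toCore

end Weighted

/-- The Sobolev space `H¹(U)`. -/
abbrev H1 (U : Opens (ℝ × ℝ)) : Type :=
  WSobolev U (volume.restrict (U : Set (ℝ × ℝ))) (volume.restrict (U : Set (ℝ × ℝ)))
    (volume.restrict (U : Set (ℝ × ℝ)))

/-! ### The sector, the rectangle and the polar map -/

/-- The polar angle of `p ≠ 0`, with values in `(0, 2π]`. -/
noncomputable def polarAngle (p : ℝ × ℝ) : ℝ := Real.pi + Complex.arg (-(⟨p.1, p.2⟩ : ℂ))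

theorem isOpen_sector (Θ : ℝ) : IsOpen {p : ℝ × ℝ |
    0 < p.1 ^ 2 + p.2 ^ 2 ∧ p.1 ^ 2 + p.2 ^ 2 < 1 ∧ 0 < polarAngle p ∧ polarAngle p < Θ} := by
  have hc : Continuous fun p : ℝ × ℝ => p.1 ^ 2 + p.2 ^ 2 := by fun_prop
  have h1 : IsOpen {p : ℝ × ℝ | 0 < p.1 ^ 2 + p.2 ^ 2} := isOpen_lt continuous_const hc
  have h2 : IsOpen {p : ℝ × ℝ | p.1 ^ 2 + p.2 ^ 2 < 1} := isOpen_lt hc continuous_const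
  have hpos : ∀ p : ℝ × ℝ, 0 < polarAngle p := fun p => by
    have := Complex.neg_pi_lt_arg (-(⟨p.1, p.2⟩ : ℂ))
    unfold polarAngle; linarith
  have hle : ∀ p : ℝ × ℝ, polarAngle p ≤ 2 * Real.pi := fun p => by
    have := Complex.arg_le_pi (-(⟨p.1, p.2⟩ : ℂ))
    unfold polarAngle; linarith
  rw [isOpen_iff_mem_nhds]
  rintro p ⟨ha, hb, -, hd⟩
  have h3 : ∀ᶠ q in nhds p, polarAngle q < Θ := by
    rcases lt_or_ge (2 * Real.pi) Θ with h | h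
    · exact Filter.Eventually.of_forall fun q => (hle q).trans_lt h
    · have hs : -(⟨p.1, p.2⟩ : ℂ) ∈ Complex.slitPlane := by
        rw [Complex.mem_slitPlane_iff_arg]
        constructor
        · intro h'
          unfold polarAngle at hd
          rw [h'] at hd
          linarith
        · intro h'
          have e1 := congrArg Complex.re h'
          have e2 := congrArg Complex.im h'
          simp only [Complex.neg_re, Complex.neg_im, Complex.zero_re, Complex.zero_im,
            neg_eq_zero] at e1 e2
          rw [e1, e2] at ha
          norm_num at ha
      have hm : Continuous fun q : ℝ × ℝ => -(⟨q.1, q.2⟩ : ℂ) :=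
        (Complex.equivRealProdCLM.symm.continuous).neg
      have : ContinuousAt polarAngle p :=
        continuousAt_const.add
          (ContinuousAt.comp (f := fun q : ℝ × ℝ => -(⟨q.1, q.2⟩ : ℂ)) (g := Complex.arg)
            (Complex.continuousAt_arg hs) hm.continuousAt)
      exact this.eventually_lt continuousAt_const hd
  filter_upwards [h1.mem_nhds ha, h2.mem_nhds hb, h3] with q q1 q2 q3
  exact ⟨q1, q2, hpos q, q3⟩

/-- The open circular sector `Ω` of radius `1` and angle `Θ`. -/
noncomputable def sector (Θ : ℝ) : Opens (ℝ × ℝ) where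
  carrier := {p | 0 < p.1 ^ 2 + p.2 ^ 2 ∧ p.1 ^ 2 + p.2 ^ 2 < 1 ∧
    0 < polarAngle p ∧ polarAngle p < Θ}
  is_open' := isOpen_sector Θ

/-- The open rectangle `Q = (0, 1) × (0, Θ)`. -/
def rect (Θ : ℝ) : Opens (ℝ × ℝ) where
  carrier := Ioo 0 1 ×ˢ Ioo 0 Θ
  is_open' := isOpen_Ioo.prod isOpen_Ioo

/-- The polar map `F(r, θ) = r (cos θ, sin θ)`. -/
noncomputable def polarMap (p : ℝ × ℝ) : ℝ × ℝ := (p.1 * Real.cos p.2, p.1 * Real.sin p.2)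

/-- The measure `r dr dθ` on `Q`; `L²_r(Q)` is `Lp ℝ 2 (measR Θ)`. -/
noncomputable def measR (Θ : ℝ) : Measure (ℝ × ℝ) := weightedMeasure (rect Θ) fun p => p.1

/-- The measure `r⁻¹ dr dθ` on `Q`; `L²_{1/r}(Q)` is `Lp ℝ 2 (measRInv Θ)`. -/
noncomputable def measRInv (Θ : ℝ) : Measure (ℝ × ℝ) := weightedMeasure (rect Θ) fun p => p.1⁻¹

instance instSameNullSetsMeasR (Θ : ℝ) : SameNullSets (rect Θ) (measR Θ) :=
  sameNullSets_weightedMeasure measurable_fst fun _ hp => hp.1.1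

instance instSameNullSetsMeasRInv (Θ : ℝ) : SameNullSets (rect Θ) (measRInv Θ) :=
  sameNullSets_weightedMeasure measurable_fst.inv fun _ hp => inv_pos.2 hp.1.1

/-- The weighted Sobolev space `H̃¹(Q)`: all `u ∈ L²_r(Q)` with `∂_r u ∈ L²_r(Q)` and
`∂_θ u ∈ L²_{1/r}(Q)`, with squared norm `∫∫ (r u² + r (∂_r u)² + r⁻¹ (∂_θ u)²) dr dθ`. -/
abbrev HTilde (Θ : ℝ) : Type := WSobolev (rect Θ) (measR Θ) (measR Θ) (measRInv Θ)

end PolarSobolev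

namespace PolarSobolev

/-! ### Pulling back weak derivatives along a diffeomorphism -/

/-! The polar map $F$ is a diffeomorphism of $Q$ onto $\Omega$ with Jacobian $r$, so it carries
$r\,dr\,d\theta$ to Lebesgue measure on $\Omega$ and composition with it is an isometry of $L^2$
(`measurePreserving_polarMap`). For gradients, $\partial_r(u\circ F)$ and
$r^{-1}\partial_\theta(u\circ F)$ are the components of $(\nabla u)\circ F$ rotated by the angle
$\theta$. The rotation preserves the sum of squares (`eLpNorm_rotation`), and $g\in L^2_{1/r}$ means
$r^{-1}g\in L^2_r$ with equal norms (`eLpNorm_measRInv`), so the two Sobolev norms agree.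

The chain rule for weak derivatives (`HasWeakPartial.comp_diffeo`) is proved by duality, without
approximation by smooth functions. If $F'e=J\,(A,B)\circ F$ with $(A,B)$ divergence free, then
$\partial_e\varphi=J\,\operatorname{div}\big((A,B)\,\varphi\circ F^{-1}\big)\circ F$; a change of
variables moves the test function to the other domain. Applied to $F$ it gives the isometry into
$\tilde H^1(Q)$, applied to $F^{-1}$ the surjectivity. The origin and the slit lie outside the open
sets, so no test function meets them. -/

/-- A function that is smooth on `U` and vanishes outside a compact subset of `U`, extended by
zero, is a test function on `U`. -/
theorem exists_test_eqOn {U : Opens (ℝ × ℝ)} {K : Set (ℝ × ℝ)} {a : ℝ × ℝ → ℝ}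
    (ha : ContDiffOn ℝ ((⊤ : ℕ∞) : WithTop ℕ∞) a U) (hK : IsCompact K) (hKU : K ⊆ U)
    (h0 : ∀ p ∈ U, p ∉ K → a p = 0) : ∃ ψ : 𝓓(U, ℝ), EqOn ψ a U := by
  classical
  have hs : Function.support ((U : Set (ℝ × ℝ)).indicator a) ⊆ K := by
    intro p hp
    rw [Function.mem_support] at hp
    by_contra hpK
    by_cases hpU : p ∈ (U : Set (ℝ × ℝ))
    · exact hp (by rw [indicator_of_mem hpU, h0 p hpU hpK])
    · exact hp (indicator_of_notMem hpU a)
  have hts : tsupport ((U : Set (ℝ × ℝ)).indicator a) ⊆ K :=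
    closure_minimal hs hK.isClosed
  refine ⟨⟨(U : Set (ℝ × ℝ)).indicator a, ?_, hK.of_isClosed_subset (isClosed_tsupport _) hts,
    hts.trans hKU⟩, fun p hp => indicator_of_mem hp a⟩
  rw [contDiff_iff_contDiffAt]
  intro p
  by_cases hpU : p ∈ (U : Set (ℝ × ℝ))
  · refine (ha.contDiffAt (U.isOpen.mem_nhds hpU)).congr_of_eventuallyEq ?_
    filter_upwards [U.isOpen.mem_nhds hpU] with x hx using indicator_of_mem hx a
  · have hp : p ∉ tsupport ((U : Set (ℝ × ℝ)).indicator a) := fun h => hpU (hKU (hts h))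
    exact contDiffAt_const.congr_of_eventuallyEq (notMem_tsupport_iff_eventuallyEq.1 hp)

/-- Chain rule for weak derivatives. Here `F : V → U` is a diffeomorphism with inverse `G` and
Jacobian `J`, and `(A, B)` is the Piola transform of the constant vector field `e`, which is
divergence free. -/
theorem HasWeakPartial.comp_diffeo {U V : Opens (ℝ × ℝ)} {e : ℝ × ℝ}
    {f g g₁ g₂ A B J : ℝ × ℝ → ℝ} {F G : ℝ × ℝ → ℝ × ℝ} {F' : ℝ × ℝ → ℝ × ℝ →L[ℝ] ℝ × ℝ}
    (h₁ : HasWeakPartial U (1, 0) f g₁) (h₂ : HasWeakPartial U (0, 1) f g₂)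
    (hFV : MapsTo F V U) (hGF : LeftInvOn G F V) (hFG : LeftInvOn F G U)
    (hF' : ∀ q ∈ V, HasFDerivAt F (F' q) q)
    (hG : ContDiffOn ℝ ((⊤ : ℕ∞) : WithTop ℕ∞) G U)
    (hA : ContDiffOn ℝ ((⊤ : ℕ∞) : WithTop ℕ∞) A U)
    (hB : ContDiffOn ℝ ((⊤ : ℕ∞) : WithTop ℕ∞) B U)
    (hdiv : ∀ p ∈ U, fderiv ℝ A p (1, 0) + fderiv ℝ B p (0, 1) = 0)
    (he : ∀ q ∈ V, F' q e = J q • (A (F q), B (F q)))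
    (hint : ∀ h : ℝ × ℝ → ℝ, ∫ p in U, h p = ∫ q in V, J q * h (F q))
    (hf : LocallyIntegrableOn (f ∘ F) V)
    (hg : LocallyIntegrableOn g V)
    (hgeq : ∀ q ∈ V, g q = J q * (A (F q) * g₁ (F q) + B (F q) * g₂ (F q))) :
    HasWeakPartial V e (f ∘ F) g := by
  refine ⟨hf, hg, fun φ => ?_⟩
  have hcG : ContDiffOn ℝ ((⊤ : ℕ∞) : WithTop ℕ∞) (φ ∘ G) U :=
    φ.contDiff.comp_contDiffOn hG
  have hK : IsCompact (F '' tsupport φ) :=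
    φ.hasCompactSupport.image_of_continuousOn fun q hq =>
      (hF' q (φ.tsupport_subset hq)).continuousAt.continuousWithinAt
  have hKU : F '' tsupport φ ⊆ U :=
    image_subset_iff.2 fun q hq => hFV (φ.tsupport_subset hq)
  have hK0 : ∀ p ∈ U, p ∉ F '' tsupport φ → φ (G p) = 0 := fun p hp hpK =>
    image_eq_zero_of_notMem_tsupport fun h => hpK ⟨G p, h, hFG hp⟩
  -- The pair $(\psi_1,\psi_2)=(A,B)\,\varphi\circ G$ is the vector test field on $U$ that
  -- corresponds to $\varphi$.
  obtain ⟨ψ₁, hψ₁⟩ := exists_test_eqOn (hA.mul hcG) hK hKU fun p hp hpK => by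
    simp [hK0 p hp hpK]
  obtain ⟨ψ₂, hψ₂⟩ := exists_test_eqOn (hB.mul hcG) hK hKU fun p hp hpK => by
    simp [hK0 p hp hpK]
  have hderiv : ∀ q ∈ V, fderiv ℝ φ q e =
      J q * (fderiv ℝ ψ₁ (F q) (1, 0) + fderiv ℝ ψ₂ (F q) (0, 1)) := by
    intro q hq
    have hn := U.isOpen.mem_nhds (hFV hq)
    have dA : DifferentiableAt ℝ A (F q) := (hA.contDiffAt hn).differentiableAt (by simp)
    have dB : DifferentiableAt ℝ B (F q) := (hB.contDiffAt hn).differentiableAt (by simp)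
    have dG : DifferentiableAt ℝ (φ ∘ G) (F q) := (hcG.contDiffAt hn).differentiableAt (by simp)
    have e₁ : fderiv ℝ ψ₁ (F q) = A (F q) • fderiv ℝ (φ ∘ G) (F q) +
        (φ ∘ G) (F q) • fderiv ℝ A (F q) := by
      rw [← fderiv_mul dA dG]
      exact (hψ₁.eventuallyEq_of_mem hn).fderiv_eq
    have e₂ : fderiv ℝ ψ₂ (F q) = B (F q) • fderiv ℝ (φ ∘ G) (F q) +
        (φ ∘ G) (F q) • fderiv ℝ B (F q) := by
      rw [← fderiv_mul dB dG]
      exact (hψ₂.eventuallyEq_of_mem hn).fderiv_eq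
    have e₃ : fderiv ℝ φ q = (fderiv ℝ (φ ∘ G) (F q)).comp (F' q) := by
      rw [← (dG.hasFDerivAt.comp q (hF' q hq)).fderiv]
      refine Filter.EventuallyEq.fderiv_eq ?_
      filter_upwards [V.isOpen.mem_nhds hq] with x hx
      simp [hGF hx]
    have e₄ : ((A (F q), B (F q)) : ℝ × ℝ) = A (F q) • (1, 0) + B (F q) • (0, 1) := by simp
    have hd := hdiv (F q) (hFV hq)
    rw [e₃, ContinuousLinearMap.comp_apply, he q hq, map_smul, e₄, map_add, map_smul, map_smul,
      e₁, e₂]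
    simp only [add_apply, smul_apply, smul_eq_mul]
    -- By the product rule, the only excess over the transport term is $\varphi\circ G$ times the
    -- divergence of $(A,B)$, which is zero.
    linear_combination (-J q * (φ ∘ G) (F q)) * hd
  have s₁ : ∫ q in V, (f ∘ F) q * fderiv ℝ φ q e =
      ∫ p in U, f p * fderiv ℝ ψ₁ p (1, 0) + f p * fderiv ℝ ψ₂ p (0, 1) := by
    rw [hint]
    refine setIntegral_congr_fun V.isOpen.measurableSet fun q hq => ?_
    simp only [Function.comp_apply]
    rw [hderiv q hq]
    ring
  have s₂ : ∫ q in V, g q * φ q =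
      ∫ p in U, g₁ p * ψ₁ p + g₂ p * ψ₂ p := by
    rw [hint]
    refine setIntegral_congr_fun V.isOpen.measurableSet fun q hq => ?_
    simp only [hgeq q hq, hψ₁ (hFV hq), hψ₂ (hFV hq), Function.comp_apply, hGF hq]
    ring
  rw [s₁, s₂, integral_add (integrableOn_mul_fderiv h₁.1 ψ₁ _)
    (integrableOn_mul_fderiv h₂.1 ψ₂ _), integral_add (integrableOn_mul_test h₁.2.1 ψ₁)
    (integrableOn_mul_test h₂.2.1 ψ₂), h₁.2.2 ψ₁, h₂.2.2 ψ₂]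
  ring

/-! ### Weighted Lebesgue spaces -/

/-- On a compact set the weight is bounded below by its positive minimum, so Lebesgue measure there
is at most a multiple of the weighted measure, and $L^2$ of a finite measure lies in $L^1$. -/
theorem locallyIntegrableOn_of_memLp {U : Opens (ℝ × ℝ)} {w f : ℝ × ℝ → ℝ}
    (hw : ContinuousOn w U) (hpos : ∀ p ∈ U, 0 < w p) (hf : MemLp f 2 (weightedMeasure U w)) :
    LocallyIntegrableOn f U := by
  rw [locallyIntegrableOn_iff U.isOpen.isLocallyClosed]
  intro K hKU hK
  rcases K.eq_empty_or_nonempty with rfl | hne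
  · simp
  obtain ⟨p₀, hp₀, hmin⟩ := hK.exists_isMinOn hne (hw.mono hKU)
  have hc : 0 < w p₀ := hpos p₀ (hKU hp₀)
  have hle : volume.restrict K ≤ (ENNReal.ofReal (w p₀))⁻¹ • weightedMeasure U w := by
    refine Measure.le_iff.2 fun s hs => ?_
    rw [Measure.smul_apply, smul_eq_mul, ← ENNReal.div_eq_inv_mul,
      ENNReal.le_div_iff_mul_le (by simp [hc]) (by simp), mul_comm, weightedMeasure,
      withDensity_apply _ hs, Measure.restrict_restrict hs, Measure.restrict_apply hs]
    calc ENNReal.ofReal (w p₀) * volume (s ∩ K)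
        = ∫⁻ _ in s ∩ K, ENNReal.ofReal (w p₀) := by simp
      _ ≤ ∫⁻ p in s ∩ K, ENNReal.ofReal (w p) :=
          setLIntegral_mono' (hs.inter hK.measurableSet) fun p hp =>
            ENNReal.ofReal_le_ofReal (hmin hp.2)
      _ ≤ ∫⁻ p in s ∩ U, ENNReal.ofReal (w p) :=
          lintegral_mono_set (inter_subset_inter_right s hKU)
  have : IsFiniteMeasure (volume.restrict K) := isFiniteMeasure_restrict.2 hK.measure_ne_top
  exact (hf.of_measure_le_smul (by simp [hc]) hle).integrable (by norm_num)

theorem weightedMeasure_one (U : Opens (ℝ × ℝ)) :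
    weightedMeasure U (fun _ => 1) = volume.restrict (U : Set (ℝ × ℝ)) := by
  simp [weightedMeasure]

theorem locallyIntegrableOn_of_memLp_restrict {U : Opens (ℝ × ℝ)} {f : ℝ × ℝ → ℝ}
    (hf : MemLp f 2 (volume.restrict (U : Set (ℝ × ℝ)))) : LocallyIntegrableOn f U :=
  locallyIntegrableOn_of_memLp (w := fun _ => 1) continuousOn_const (fun _ _ => one_pos)
    (by rwa [weightedMeasure_one])

theorem locallyIntegrableOn_of_memLp_measR {Θ : ℝ} {f : ℝ × ℝ → ℝ}
    (hf : MemLp f 2 (measR Θ)) : LocallyIntegrableOn f (rect Θ) :=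
  locallyIntegrableOn_of_memLp continuous_fst.continuousOn (fun _ hp => hp.1.1) hf

theorem locallyIntegrableOn_of_memLp_measRInv {Θ : ℝ} {f : ℝ × ℝ → ℝ}
    (hf : MemLp f 2 (measRInv Θ)) : LocallyIntegrableOn f (rect Θ) :=
  locallyIntegrableOn_of_memLp (continuous_fst.continuousOn.inv₀ fun _ hp => hp.1.1.ne')
    (fun _ hp => inv_pos.2 hp.1.1) hf

theorem aestronglyMeasurable_iff_of_sameNullSets {U : Opens (ℝ × ℝ)} {μ ν : Measure (ℝ × ℝ)}
    [SameNullSets U μ] [SameNullSets U ν] {f : ℝ × ℝ → ℝ} :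
    AEStronglyMeasurable f μ ↔ AEStronglyMeasurable f ν :=
  ⟨fun h => h.mono_ac ((SameNullSets.ac (U := U)).trans SameNullSets.ca),
    fun h => h.mono_ac ((SameNullSets.ac (U := U)).trans SameNullSets.ca)⟩

theorem ae_restrict_iff_measR {Θ : ℝ} {P : ℝ × ℝ → Prop} :
    (∀ᵐ p ∂(measR Θ), P p) ↔ ∀ᵐ p ∂(volume.restrict (rect Θ : Set (ℝ × ℝ))), P p :=
  ⟨fun h => (SameNullSets.ca (U := rect Θ) (μ := measR Θ)).ae_le h,
    fun h => (SameNullSets.ac (U := rect Θ) (μ := measR Θ)).ae_le h⟩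

theorem ae_measR_mem (Θ : ℝ) : ∀ᵐ p ∂(measR Θ), p ∈ rect Θ :=
  ae_restrict_iff_measR.2 (ae_restrict_mem (rect Θ).isOpen.measurableSet)

/-- Pointwise this is $r^{-1}=r\cdot(r^{-1})^2$. It lets both components of the polar gradient be
measured in $L^2_r$. -/
theorem eLpNorm_measRInv (Θ : ℝ) (f : ℝ × ℝ → ℝ) :
    eLpNorm f 2 (measRInv Θ) = eLpNorm (fun p => p.1⁻¹ * f p) 2 (measR Θ) := by
  rw [eLpNorm_eq_lintegral_rpow_enorm_toReal (by simp) (by simp),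
    eLpNorm_eq_lintegral_rpow_enorm_toReal (by simp) (by simp), measR, measRInv,
    weightedMeasure, weightedMeasure,
    lintegral_withDensity_eq_lintegral_mul_non_measurable _
      (f := fun p : ℝ × ℝ => ENNReal.ofReal p.1⁻¹) (measurable_fst.inv.ennreal_ofReal) (by simp),
    lintegral_withDensity_eq_lintegral_mul_non_measurable _
      (measurable_fst.ennreal_ofReal) (by simp)]
  congr 1
  refine setLIntegral_congr_fun (rect Θ).isOpen.measurableSet fun p hp => ?_
  have hr : 0 < p.1 := hp.1.1
  simp only [Pi.mul_apply, enorm_mul, ENNReal.toReal_ofNat, ENNReal.rpow_ofNat, mul_pow,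
    Real.enorm_of_nonneg (inv_nonneg.2 hr.le), ← mul_assoc]
  congr 1
  rw [← ENNReal.ofReal_pow (inv_nonneg.2 hr.le), ← ENNReal.ofReal_mul hr.le]
  congr 1
  field_simp

theorem memLp_measRInv_iff {Θ : ℝ} {f : ℝ × ℝ → ℝ} :
    MemLp f 2 (measRInv Θ) ↔ MemLp (fun p => p.1⁻¹ * f p) 2 (measR Θ) := by
  rw [MemLp, MemLp, eLpNorm_measRInv,
    aestronglyMeasurable_iff_of_sameNullSets (U := rect Θ) (μ := measRInv Θ) (ν := measR Θ)]
  refine and_congr_left fun _ => ⟨fun h => ?_, fun h => ?_⟩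
  · exact measurable_fst.inv.aestronglyMeasurable.mul h
  · refine (measurable_fst.aestronglyMeasurable.mul h).congr ?_
    filter_upwards [ae_measR_mem Θ] with p hp
    have hr : 0 < p.1 := hp.1.1
    simp [hr.ne']

/-! ### The polar map as a diffeomorphism from the rectangle onto the sector -/

/-- The inverse of the polar map on the sector. -/
noncomputable def polarInv (p : ℝ × ℝ) : ℝ × ℝ := (√(p.1 ^ 2 + p.2 ^ 2), polarAngle p)

theorem mem_sector {Θ : ℝ} {p : ℝ × ℝ} :
    p ∈ sector Θ ↔ 0 < p.1 ^ 2 + p.2 ^ 2 ∧ p.1 ^ 2 + p.2 ^ 2 < 1 ∧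
      0 < polarAngle p ∧ polarAngle p < Θ := Iff.rfl

theorem polarMap_sq (q : ℝ × ℝ) : (polarMap q).1 ^ 2 + (polarMap q).2 ^ 2 = q.1 ^ 2 := by
  simp only [polarMap]
  linear_combination q.1 ^ 2 * Real.cos_sq_add_sin_sq q.2

theorem sqrt_polarMap {q : ℝ × ℝ} (hq : 0 ≤ q.1) :
    √((polarMap q).1 ^ 2 + (polarMap q).2 ^ 2) = q.1 := by
  rw [polarMap_sq, Real.sqrt_sq hq]

/-- The point $-F(r,\theta)$ has argument $\theta-\pi\in(-\pi,\pi]$, the range of the principal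
branch; this is why the angle is defined through $-p$. -/
theorem polarAngle_polarMap {q : ℝ × ℝ} (h0 : 0 < q.1) (h1 : 0 < q.2)
    (h2 : q.2 ≤ 2 * Real.pi) : polarAngle (polarMap q) = q.2 := by
  have h := Complex.arg_mul_cos_add_sin_mul_I (r := q.1) (θ := q.2 - Real.pi) h0
    ⟨by linarith, by linarith⟩
  have e : -(⟨(polarMap q).1, (polarMap q).2⟩ : ℂ) =
      q.1 * (Complex.cos (q.2 - Real.pi : ℝ) + Complex.sin (q.2 - Real.pi : ℝ) * Complex.I) := by
    rw [← Complex.ofReal_cos, ← Complex.ofReal_sin, Real.cos_sub_pi, Real.sin_sub_pi]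
    apply Complex.ext <;> simp [polarMap, -Complex.ofReal_cos, -Complex.ofReal_sin]
  rw [polarAngle, e, h]
  ring

theorem polarMap_polarInv (p : ℝ × ℝ) : polarMap (polarInv p) = p := by
  have hn : √(p.1 ^ 2 + p.2 ^ 2) = ‖-(⟨p.1, p.2⟩ : ℂ)‖ := by
    rw [norm_neg, Complex.norm_def, Complex.normSq_mk]
    ring_nf
  have hc := Complex.norm_mul_cos_arg (-(⟨p.1, p.2⟩ : ℂ))
  have hs := Complex.norm_mul_sin_arg (-(⟨p.1, p.2⟩ : ℂ))
  simp only [Complex.neg_re, Complex.neg_im] at hc hs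
  simp only [polarMap, polarInv, polarAngle, hn, add_comm Real.pi, Real.cos_add_pi,
    Real.sin_add_pi, mul_neg, hc, hs, neg_neg]

theorem polarInv_mapsTo (Θ : ℝ) : MapsTo polarInv (sector Θ) (rect Θ) := by
  rintro p ⟨h0, h1, h2, h3⟩
  exact ⟨⟨Real.sqrt_pos.2 h0, (Real.sqrt_lt' one_pos).2 (by simpa using h1)⟩, h2, h3⟩

theorem polarMap_mapsTo {Θ : ℝ} (hΘ : Θ ≤ 2 * Real.pi) :
    MapsTo polarMap (rect Θ) (sector Θ) := by
  rintro q ⟨⟨h0, h1⟩, h2, h3⟩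
  simp only [SetLike.mem_coe, mem_sector, polarMap_sq, polarAngle_polarMap h0 h2 (h3.le.trans hΘ)]
  exact ⟨by positivity, by nlinarith, h2, h3⟩

theorem polarInv_polarMap {Θ : ℝ} (hΘ : Θ ≤ 2 * Real.pi) :
    LeftInvOn polarInv polarMap (rect Θ) := by
  rintro q ⟨⟨h0, h1⟩, h2, h3⟩
  rw [polarInv, sqrt_polarMap h0.le, polarAngle_polarMap h0 h2 (h3.le.trans hΘ)]

theorem image_polarMap_rect {Θ : ℝ} (hΘ : Θ ≤ 2 * Real.pi) :
    polarMap '' rect Θ = sector Θ :=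
  (polarMap_mapsTo hΘ).image_subset.antisymm fun p hp =>
    ⟨polarInv p, polarInv_mapsTo Θ hp, polarMap_polarInv p⟩

theorem hasFDerivAt_polarMap (q : ℝ × ℝ) :
    HasFDerivAt polarMap (fderivPolarCoordSymm q) q :=
  hasFDerivAt_polarCoord_symm q

theorem fderivPolarCoordSymm_apply (q v : ℝ × ℝ) :
    fderivPolarCoordSymm q v =
      (Real.cos q.2 * v.1 - q.1 * Real.sin q.2 * v.2,
        Real.sin q.2 * v.1 + q.1 * Real.cos q.2 * v.2) := by
  rw [fderivPolarCoordSymm, Matrix.toLin_finTwoProd_toContinuousLinearMap]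
  ext <;> simp [sub_eq_add_neg]

theorem contDiff_polarMap {n : WithTop ℕ∞} : ContDiff ℝ n polarMap :=
  (contDiff_fst.mul (Real.contDiff_cos.comp contDiff_snd)).prodMk
    (contDiff_fst.mul (Real.contDiff_sin.comp contDiff_snd))

theorem contDiffAt_polarAngle {Θ : ℝ} (hΘ : Θ ≤ 2 * Real.pi) {p : ℝ × ℝ} (hp : p ∈ sector Θ)
    {n : WithTop ℕ∞} : ContDiffAt ℝ n polarAngle p := by
  obtain ⟨h0, h1, h2, h3⟩ := hp
  -- The argument $\pi$ of $-p$ would mean polar angle $2\pi\ge\Theta$. Off the cut, the argument is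
  -- the imaginary part of the smooth function $\log$.
  have hs : -(⟨p.1, p.2⟩ : ℂ) ∈ Complex.slitPlane := by
    rw [Complex.mem_slitPlane_iff_arg]
    constructor
    · intro h'
      rw [polarAngle, h'] at h3
      linarith
    · intro h'
      have e1 := congrArg Complex.re h'
      have e2 := congrArg Complex.im h'
      simp only [Complex.neg_re, Complex.neg_im, Complex.zero_re, Complex.zero_im,
        neg_eq_zero] at e1 e2
      simp [e1, e2] at h0
  have hm : ContDiffAt ℝ n (fun q : ℝ × ℝ => -(⟨q.1, q.2⟩ : ℂ)) p :=
    (Complex.equivRealProdCLM.symm.contDiff (n := n)).neg.contDiffAt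
  have hl : ContDiffAt ℝ n Complex.log (-(⟨p.1, p.2⟩ : ℂ)) :=
    (Complex.contDiffAt_log hs).restrict_scalars ℝ
  have h : ContDiffAt ℝ n (fun q : ℝ × ℝ => (Complex.log (-(⟨q.1, q.2⟩ : ℂ))).im) p :=
    Complex.imCLM.contDiff.contDiffAt.comp p (ContDiffAt.comp (g := Complex.log) p hl hm)
  simp only [Complex.log_im] at h
  exact contDiffAt_const.add h

theorem contDiff_sq_add_sq {n : WithTop ℕ∞} :
    ContDiff ℝ n fun p : ℝ × ℝ => p.1 ^ 2 + p.2 ^ 2 := by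
  fun_prop

theorem contDiffOn_sqrt_sector (Θ : ℝ) {n : WithTop ℕ∞} :
    ContDiffOn ℝ n (fun p : ℝ × ℝ => √(p.1 ^ 2 + p.2 ^ 2)) (sector Θ) :=
  contDiff_sq_add_sq.contDiffOn.sqrt fun _ hp => hp.1.ne'

theorem contDiffOn_polarInv {Θ : ℝ} (hΘ : Θ ≤ 2 * Real.pi) {n : WithTop ℕ∞} :
    ContDiffOn ℝ n polarInv (sector Θ) :=
  (contDiffOn_sqrt_sector Θ).prodMk fun _ hp => (contDiffAt_polarAngle hΘ hp).contDiffWithinAt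

theorem measurable_polarInv : Measurable polarInv := by
  refine Measurable.prodMk (by fun_prop) ?_
  have : Measurable fun q : ℝ × ℝ => -(⟨q.1, q.2⟩ : ℂ) :=
    (Complex.equivRealProdCLM.symm.continuous.neg).measurable
  exact measurable_const.add (Complex.measurable_arg.comp this)

/-- The derivative of the inverse of the polar map solves the linear system given by the
derivative of the polar map. -/
theorem fderiv_polarInv_apply {Θ : ℝ} (hΘ : Θ ≤ 2 * Real.pi) {p : ℝ × ℝ} (hp : p ∈ sector Θ)
    (v : ℝ × ℝ) : fderiv ℝ polarInv p v = (√(p.1 ^ 2 + p.2 ^ 2))⁻¹ •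
      ((polarInv p).1 * (Real.cos (polarInv p).2 * v.1 + Real.sin (polarInv p).2 * v.2),
        Real.cos (polarInv p).2 * v.2 - Real.sin (polarInv p).2 * v.1) := by
  have hd : HasFDerivAt polarInv (fderiv ℝ polarInv p) p :=
    (((contDiffOn_polarInv hΘ (n := 1)).contDiffAt
      ((sector Θ).isOpen.mem_nhds hp)).differentiableAt (by simp)).hasFDerivAt
  have hc := (hasFDerivAt_polarMap (polarInv p)).comp p hd
  -- This identity holds on the whole plane, so it can be differentiated at $p$ directly; the
  -- resulting system is solved by applying the inverse rotation.
  have hid : polarMap ∘ polarInv = id := funext polarMap_polarInv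
  rw [hid] at hc
  have h := DFunLike.congr_fun (hc.unique (hasFDerivAt_id p)) v
  rw [ContinuousLinearMap.comp_apply, fderivPolarCoordSymm_apply] at h
  have h1 := congrArg Prod.fst h
  have h2 := congrArg Prod.snd h
  simp only [ContinuousLinearMap.id_apply] at h1 h2
  have hr : (polarInv p).1 ≠ 0 := (polarInv_mapsTo Θ hp).1.1.ne'
  have hρ : √(p.1 ^ 2 + p.2 ^ 2) = (polarInv p).1 := rfl
  have hcs := Real.cos_sq_add_sin_sq (polarInv p).2
  rw [hρ]
  ext
  · simp only [Prod.smul_fst, smul_eq_mul, inv_mul_cancel_left₀ hr]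
    linear_combination Real.cos (polarInv p).2 * h1 + Real.sin (polarInv p).2 * h2 -
      (fderiv ℝ polarInv p v).1 * hcs
  · simp only [Prod.smul_snd, smul_eq_mul]
    rw [eq_inv_mul_iff_mul_eq₀ hr]
    linear_combination Real.cos (polarInv p).2 * h2 - Real.sin (polarInv p).2 * h1 -
      (polarInv p).1 * (fderiv ℝ polarInv p v).2 * hcs

/-! ### Change of variables -/

/-- This is the area formula: $F$ is injective on $Q$ and $|\det F'|=r$ there. -/
theorem measurePreserving_polarMap {Θ : ℝ} (hΘ : Θ ≤ 2 * Real.pi) :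
    MeasurePreserving polarMap (measR Θ) (volume.restrict (sector Θ : Set (ℝ × ℝ))) := by
  have hm : Measurable polarMap := (contDiff_polarMap (n := 0)).continuous.measurable
  refine ⟨hm, Measure.ext fun s hs => ?_⟩
  have hms : MeasurableSet (polarMap ⁻¹' s ∩ rect Θ) :=
    (hm hs).inter (rect Θ).isOpen.measurableSet
  have hi : polarMap '' (polarMap ⁻¹' s ∩ rect Θ) = s ∩ sector Θ := by
    rw [image_preimage_inter, image_polarMap_rect hΘ]
  rw [Measure.map_apply hm hs, Measure.restrict_apply hs, measR, weightedMeasure,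
    withDensity_apply _ (hm hs), Measure.restrict_restrict (hm hs), ← hi,
    ← lintegral_abs_det_fderiv_eq_addHaar_image volume hms
      (fun q _ => (hasFDerivAt_polarMap q).hasFDerivWithinAt)
      ((polarInv_polarMap hΘ).injOn.mono inter_subset_right)]
  refine setLIntegral_congr_fun hms fun q hq => ?_
  simp only [det_fderivPolarCoordSymm, abs_of_pos hq.2.1.1]

/-- Push the previous identity forward by the inverse map and use that the composition is the
identity almost everywhere on $Q$. -/
theorem measurePreserving_polarInv {Θ : ℝ} (hΘ : Θ ≤ 2 * Real.pi) :
    MeasurePreserving polarInv (volume.restrict (sector Θ : Set (ℝ × ℝ))) (measR Θ) := by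
  refine ⟨measurable_polarInv, ?_⟩
  rw [← (measurePreserving_polarMap hΘ).map_eq,
    Measure.map_map measurable_polarInv (measurePreserving_polarMap hΘ).measurable]
  conv_rhs => rw [← Measure.map_id (μ := measR Θ)]
  refine Measure.map_congr ?_
  filter_upwards [ae_measR_mem Θ] with q hq using polarInv_polarMap hΘ hq

theorem integral_sector {Θ : ℝ} (hΘ : Θ ≤ 2 * Real.pi) (h : ℝ × ℝ → ℝ) :
    ∫ p in sector Θ, h p = ∫ q in rect Θ, q.1 * h (polarMap q) := by
  rw [← image_polarMap_rect hΘ, integral_image_eq_integral_abs_det_fderiv_smul volume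
    (rect Θ).isOpen.measurableSet (fun q _ => (hasFDerivAt_polarMap q).hasFDerivWithinAt)
    (polarInv_polarMap hΘ).injOn]
  refine setIntegral_congr_fun (rect Θ).isOpen.measurableSet fun q hq => ?_
  simp only [det_fderivPolarCoordSymm, abs_of_pos hq.1.1, smul_eq_mul]

theorem integral_rect {Θ : ℝ} (hΘ : Θ ≤ 2 * Real.pi) (h : ℝ × ℝ → ℝ) :
    ∫ q in rect Θ, h q =
      ∫ p in sector Θ, (√(p.1 ^ 2 + p.2 ^ 2))⁻¹ * h (polarInv p) := by
  rw [integral_sector hΘ]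
  refine setIntegral_congr_fun (rect Θ).isOpen.measurableSet fun q hq => ?_
  have hr : 0 < q.1 := hq.1.1
  simp only [sqrt_polarMap hr.le, polarInv_polarMap hΘ hq, mul_inv_cancel_left₀ hr.ne']

/-! ### Weak derivatives in polar coordinates -/

section WeakPolar

variable {Θ : ℝ} {f g g₁ g₂ : ℝ × ℝ → ℝ}

theorem hasFDerivAt_sqrt_sq_add_sq {p : ℝ × ℝ} (hp : 0 < p.1 ^ 2 + p.2 ^ 2) :
    HasFDerivAt (fun p : ℝ × ℝ => √(p.1 ^ 2 + p.2 ^ 2))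
      ((√(p.1 ^ 2 + p.2 ^ 2))⁻¹ • (p.1 • ContinuousLinearMap.fst ℝ ℝ ℝ +
        p.2 • ContinuousLinearMap.snd ℝ ℝ ℝ)) p := by
  have h := (((hasFDerivAt_fst (𝕜 := ℝ) (p := p)).pow 2).add
    ((hasFDerivAt_snd (𝕜 := ℝ) (p := p)).pow 2)).sqrt hp.ne'
  refine h.congr_fderiv ?_
  ext <;> simp <;> field_simp

/-- Here $\partial_rF=(\cos\theta,\sin\theta)=r\cdot p/|p|^2$ at $p=F(r,\theta)$, and $p/|p|^2$ is
divergence free away from the origin. -/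
theorem HasWeakPartial.radial (hΘ : Θ ≤ 2 * Real.pi)
    (h₁ : HasWeakPartial (sector Θ) (1, 0) f g₁) (h₂ : HasWeakPartial (sector Θ) (0, 1) f g₂)
    (hf : LocallyIntegrableOn (f ∘ polarMap) (rect Θ)) (hg : LocallyIntegrableOn g (rect Θ))
    (hgeq : ∀ q ∈ rect Θ,
      g q = Real.cos q.2 * g₁ (polarMap q) + Real.sin q.2 * g₂ (polarMap q)) :
    HasWeakPartial (rect Θ) (1, 0) (f ∘ polarMap) g := by
  have hne : ∀ p ∈ sector Θ, p.1 ^ 2 + p.2 ^ 2 ≠ 0 := fun p hp => hp.1.ne'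
  refine h₁.comp_diffeo (A := fun p => p.1 * (p.1 ^ 2 + p.2 ^ 2)⁻¹)
    (B := fun p => p.2 * (p.1 ^ 2 + p.2 ^ 2)⁻¹) (J := fun q => q.1) (G := polarInv) h₂
    (polarMap_mapsTo hΘ) (polarInv_polarMap hΘ) (fun p _ => polarMap_polarInv p)
    (fun q _ => hasFDerivAt_polarMap q) (contDiffOn_polarInv hΘ)
    (contDiff_fst.contDiffOn.mul (contDiff_sq_add_sq.contDiffOn.inv hne))
    (contDiff_snd.contDiffOn.mul (contDiff_sq_add_sq.contDiffOn.inv hne))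
    ?_ ?_ (integral_sector hΘ) hf hg ?_
  · intro p hp
    have hN := ((hasFDerivAt_fst (𝕜 := ℝ) (p := p)).pow 2).add
      ((hasFDerivAt_snd (𝕜 := ℝ) (p := p)).pow 2)
    have hI := (hasDerivAt_inv (hne p hp)).comp_hasFDerivAt p hN
    have hA := (hasFDerivAt_fst (𝕜 := ℝ) (p := p)).mul hI
    have hB := (hasFDerivAt_snd (𝕜 := ℝ) (p := p)).mul hI
    have eA := hA.fderiv
    have eB := hB.fderiv
    simp only [Function.comp_def, Pi.mul_def, Pi.add_apply] at eA eB
    rw [eA, eB]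
    have := hne p hp
    simp
    field_simp
    ring
  · intro q hq
    have hr : q.1 ≠ 0 := hq.1.1.ne'
    rw [fderivPolarCoordSymm_apply, polarMap_sq]
    ext <;> simp [polarMap] <;> field_simp
  · intro q hq
    have hr : q.1 ≠ 0 := hq.1.1.ne'
    rw [hgeq q hq, polarMap_sq]
    simp only [polarMap]
    field_simp

/-- Here $\partial_\theta F=r\cdot(-y,x)/|p|$, and a rotation field scaled by a radial function is
divergence free. -/
theorem HasWeakPartial.angular (hΘ : Θ ≤ 2 * Real.pi)
    (h₁ : HasWeakPartial (sector Θ) (1, 0) f g₁) (h₂ : HasWeakPartial (sector Θ) (0, 1) f g₂)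
    (hf : LocallyIntegrableOn (f ∘ polarMap) (rect Θ)) (hg : LocallyIntegrableOn g (rect Θ))
    (hgeq : ∀ q ∈ rect Θ,
      g q = q.1 * (Real.cos q.2 * g₂ (polarMap q) - Real.sin q.2 * g₁ (polarMap q))) :
    HasWeakPartial (rect Θ) (0, 1) (f ∘ polarMap) g := by
  have hne : ∀ p ∈ sector Θ, √(p.1 ^ 2 + p.2 ^ 2) ≠ 0 := fun p hp => (Real.sqrt_pos.2 hp.1).ne'
  refine h₁.comp_diffeo (A := fun p => -p.2 * (√(p.1 ^ 2 + p.2 ^ 2))⁻¹)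
    (B := fun p => p.1 * (√(p.1 ^ 2 + p.2 ^ 2))⁻¹) (J := fun q => q.1) (G := polarInv) h₂
    (polarMap_mapsTo hΘ) (polarInv_polarMap hΘ) (fun p _ => polarMap_polarInv p)
    (fun q _ => hasFDerivAt_polarMap q) (contDiffOn_polarInv hΘ)
    (contDiff_snd.neg.contDiffOn.mul ((contDiffOn_sqrt_sector Θ).inv hne))
    (contDiff_fst.contDiffOn.mul ((contDiffOn_sqrt_sector Θ).inv hne))
    ?_ ?_ (integral_sector hΘ) hf hg ?_
  · intro p hp
    have hI := (hasDerivAt_inv (hne p hp)).comp_hasFDerivAt p (hasFDerivAt_sqrt_sq_add_sq hp.1)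
    have hA := (hasFDerivAt_snd (𝕜 := ℝ) (p := p)).neg.mul hI
    have hB := (hasFDerivAt_fst (𝕜 := ℝ) (p := p)).mul hI
    have eA := hA.fderiv
    have eB := hB.fderiv
    simp only [Function.comp_def, Pi.mul_def, Pi.neg_apply] at eA eB
    rw [eA, eB]
    simp
    ring
  · intro q hq
    have hr : 0 < q.1 := hq.1.1
    rw [fderivPolarCoordSymm_apply, sqrt_polarMap hr.le]
    ext <;> simp [polarMap] <;> left <;> field_simp
  · intro q hq
    have hr : 0 < q.1 := hq.1.1
    rw [hgeq q hq, sqrt_polarMap hr.le]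
    simp only [polarMap]
    field_simp
    ring

/-- The inverse map has Jacobian $1/r$ and $x$-derivative $r^{-1}(r\cos\theta,-\sin\theta)$, where
$\partial_r(r\cos\theta)+\partial_\theta(-\sin\theta)=0$. -/
theorem HasWeakPartial.comp_polarInv_fst (hΘ : Θ ≤ 2 * Real.pi)
    (h₁ : HasWeakPartial (rect Θ) (1, 0) f g₁) (h₂ : HasWeakPartial (rect Θ) (0, 1) f g₂)
    (hf : LocallyIntegrableOn (f ∘ polarInv) (sector Θ))
    (hg : LocallyIntegrableOn (g ∘ polarInv) (sector Θ))
    (hgeq : ∀ q ∈ rect Θ,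
      g q = Real.cos q.2 * g₁ q - Real.sin q.2 * (q.1⁻¹ * g₂ q)) :
    HasWeakPartial (sector Θ) (1, 0) (f ∘ polarInv) (g ∘ polarInv) := by
  refine h₁.comp_diffeo (A := fun q => q.1 * Real.cos q.2) (B := fun q => -Real.sin q.2)
    (J := fun p => (√(p.1 ^ 2 + p.2 ^ 2))⁻¹) (G := polarMap) h₂
    (polarInv_mapsTo Θ) (fun p _ => polarMap_polarInv p) (polarInv_polarMap hΘ)
    (fun p hp => (((contDiffOn_polarInv hΘ (n := 1)).contDiffAt
      ((sector Θ).isOpen.mem_nhds hp)).differentiableAt (by simp)).hasFDerivAt)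
    contDiff_polarMap.contDiffOn (by fun_prop) (by fun_prop) ?_ ?_ (integral_rect hΘ) hf hg ?_
  · intro q hq
    have hA := (hasFDerivAt_fst (𝕜 := ℝ) (p := q)).mul
      ((Real.hasDerivAt_cos q.2).comp_hasFDerivAt q (hasFDerivAt_snd (𝕜 := ℝ) (p := q)))
    have hB := ((Real.hasDerivAt_sin q.2).comp_hasFDerivAt q
      (hasFDerivAt_snd (𝕜 := ℝ) (p := q))).neg
    have eA := hA.fderiv
    have eB := hB.fderiv
    simp only [Function.comp_def, Pi.mul_def, Pi.neg_def] at eA eB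
    rw [eA, eB]
    simp
  · intro p hp
    rw [fderiv_polarInv_apply hΘ hp]
    simp
  · intro p hp
    have hr : (polarInv p).1 ≠ 0 := (polarInv_mapsTo Θ hp).1.1.ne'
    rw [Function.comp_apply, hgeq _ (polarInv_mapsTo Θ hp),
      show √(p.1 ^ 2 + p.2 ^ 2) = (polarInv p).1 from rfl]
    field_simp
    ring

/-- As for the $x$-derivative, now with the divergence-free field $(r\sin\theta,\cos\theta)$. -/
theorem HasWeakPartial.comp_polarInv_snd (hΘ : Θ ≤ 2 * Real.pi)
    (h₁ : HasWeakPartial (rect Θ) (1, 0) f g₁) (h₂ : HasWeakPartial (rect Θ) (0, 1) f g₂)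
    (hf : LocallyIntegrableOn (f ∘ polarInv) (sector Θ))
    (hg : LocallyIntegrableOn (g ∘ polarInv) (sector Θ))
    (hgeq : ∀ q ∈ rect Θ,
      g q = Real.sin q.2 * g₁ q + Real.cos q.2 * (q.1⁻¹ * g₂ q)) :
    HasWeakPartial (sector Θ) (0, 1) (f ∘ polarInv) (g ∘ polarInv) := by
  refine h₁.comp_diffeo (A := fun q => q.1 * Real.sin q.2) (B := fun q => Real.cos q.2)
    (J := fun p => (√(p.1 ^ 2 + p.2 ^ 2))⁻¹) (G := polarMap) h₂
    (polarInv_mapsTo Θ) (fun p _ => polarMap_polarInv p) (polarInv_polarMap hΘ)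
    (fun p hp => (((contDiffOn_polarInv hΘ (n := 1)).contDiffAt
      ((sector Θ).isOpen.mem_nhds hp)).differentiableAt (by simp)).hasFDerivAt)
    contDiff_polarMap.contDiffOn (by fun_prop) (by fun_prop) ?_ ?_ (integral_rect hΘ) hf hg ?_
  · intro q hq
    have hA := (hasFDerivAt_fst (𝕜 := ℝ) (p := q)).mul
      ((Real.hasDerivAt_sin q.2).comp_hasFDerivAt q (hasFDerivAt_snd (𝕜 := ℝ) (p := q)))
    have hB := (Real.hasDerivAt_cos q.2).comp_hasFDerivAt q
      (hasFDerivAt_snd (𝕜 := ℝ) (p := q))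
    have eA := hA.fderiv
    have eB := hB.fderiv
    simp only [Function.comp_def, Pi.mul_def] at eA eB
    rw [eA, eB]
    simp
  · intro p hp
    rw [fderiv_polarInv_apply hΘ hp]
    simp
  · intro p hp
    have hr : (polarInv p).1 ≠ 0 := (polarInv_mapsTo Θ hp).1.1.ne'
    rw [Function.comp_apply, hgeq _ (polarInv_mapsTo Θ hp),
      show √(p.1 ^ 2 + p.2 ^ 2) = (polarInv p).1 from rfl]
    field_simp

end WeakPolar

/-! ### Elements and norms of weighted Sobolev spaces -/

section WSobolev

variable {U : Opens (ℝ × ℝ)} {μ₀ μ₁ μ₂ : Measure (ℝ × ℝ)}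
  [SameNullSets U μ₀] [SameNullSets U μ₁] [SameNullSets U μ₂]

theorem WSobolev.toL2_injective :
    Function.Injective (WSobolev.toL2 : WSobolev U μ₀ μ₁ μ₂ →ₗ[ℝ] Lp ℝ 2 μ₀) :=
  Subtype.val_injective

theorem WSobolev.hasWeakPartial_d₁ (u : WSobolev U μ₀ μ₁ μ₂) :
    HasWeakPartial U (1, 0) u.toL2 u.d₁ :=
  (Submodule.inclusion inf_le_left u :
    weakSubmodule U μ₀ μ₁ (1, 0)).2.choose_spec

theorem WSobolev.hasWeakPartial_d₂ (u : WSobolev U μ₀ μ₁ μ₂) :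
    HasWeakPartial U (0, 1) u.toL2 u.d₂ :=
  (Submodule.inclusion inf_le_right u :
    weakSubmodule U μ₀ μ₂ (0, 1)).2.choose_spec

theorem WSobolev.norm_sq_eq (u : WSobolev U μ₀ μ₁ μ₂) :
    ‖u‖ ^ 2 = ‖u.toL2‖ ^ 2 + ‖u.d₁‖ ^ 2 + ‖u.d₂‖ ^ 2 := by
  rw [← real_inner_self_eq_norm_sq u, ← real_inner_self_eq_norm_sq u.toL2,
    ← real_inner_self_eq_norm_sq u.d₁, ← real_inner_self_eq_norm_sq u.d₂]
  rfl

/-- Uniqueness of weak derivatives identifies the derivatives picked by choice with explicit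
formulas, which is what makes the norm computable. -/
theorem WSobolev.exists_of_hasWeakPartial {f g₁ g₂ : ℝ × ℝ → ℝ} (u : Lp ℝ 2 μ₀)
    (hu : u =ᵐ[μ₀] f) (h₁ : MemLp g₁ 2 μ₁) (h₂ : MemLp g₂ 2 μ₂)
    (hw₁ : HasWeakPartial U (1, 0) f g₁) (hw₂ : HasWeakPartial U (0, 1) f g₂) :
    ∃ v : WSobolev U μ₀ μ₁ μ₂, v.toL2 = u ∧ v.d₁ =ᵐ[μ₁] g₁ ∧ v.d₂ =ᵐ[μ₂] g₂ := by
  have hu' := (SameNullSets.ca (U := U)).ae_eq hu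
  let v : WSobolev U μ₀ μ₁ μ₂ := ⟨u,
    ⟨h₁.toLp g₁, hw₁.congr hu'.symm (SameNullSets.ca.ae_eq h₁.coeFn_toLp.symm)⟩,
    ⟨h₂.toLp g₂, hw₂.congr hu'.symm (SameNullSets.ca.ae_eq h₂.coeFn_toLp.symm)⟩⟩
  have hv : (v.toL2 : ℝ × ℝ → ℝ) =ᵐ[volume.restrict (U : Set (ℝ × ℝ))] f := hu'
  exact ⟨v, rfl,
    SameNullSets.ac.ae_eq ((v.hasWeakPartial_d₁.congr hv ae_eq_rfl).unique hw₁),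
    SameNullSets.ac.ae_eq ((v.hasWeakPartial_d₂.congr hv ae_eq_rfl).unique hw₂)⟩

end WSobolev

/-! ### Pointwise rotations of pairs of $L^2$ functions -/

theorem toReal_eLpNorm_sq {μ : Measure (ℝ × ℝ)} {f : ℝ × ℝ → ℝ} (hf : MemLp f 2 μ) :
    (eLpNorm f 2 μ).toReal ^ 2 = ∫ p, f p ^ 2 ∂μ := by
  rw [← Lp.norm_toLp f hf, ← real_inner_self_eq_norm_sq, L2.inner_def]
  refine integral_congr_ae ?_
  filter_upwards [hf.coeFn_toLp] with p hp
  simp [hp, sq]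

theorem memLp_bounded_mul {μ : Measure (ℝ × ℝ)} {b f : ℝ × ℝ → ℝ} (hb : Continuous b)
    (hb1 : ∀ p, |b p| ≤ 1) (hf : MemLp f 2 μ) : MemLp (fun p => b p * f p) 2 μ := by
  refine hf.mono (hb.aestronglyMeasurable.mul hf.1) (Filter.Eventually.of_forall fun p => ?_)
  rw [norm_mul]
  exact mul_le_of_le_one_left (norm_nonneg _) (hb1 p)

section Rotation

variable {μ : Measure (ℝ × ℝ)} {a b : ℝ × ℝ → ℝ}

theorem memLp_cos_add_sin (ha : MemLp a 2 μ) (hb : MemLp b 2 μ) :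
    MemLp (fun q => Real.cos q.2 * a q + Real.sin q.2 * b q) 2 μ :=
  (memLp_bounded_mul (b := fun q => Real.cos q.2) (by fun_prop)
    (fun _ => Real.abs_cos_le_one _) ha).add
    (memLp_bounded_mul (b := fun q => Real.sin q.2) (by fun_prop)
    (fun _ => Real.abs_sin_le_one _) hb)

theorem memLp_cos_sub_sin (ha : MemLp a 2 μ) (hb : MemLp b 2 μ) :
    MemLp (fun q => Real.cos q.2 * b q - Real.sin q.2 * a q) 2 μ :=
  (memLp_bounded_mul (b := fun q => Real.cos q.2) (by fun_prop)
    (fun _ => Real.abs_cos_le_one _) hb).sub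
    (memLp_bounded_mul (b := fun q => Real.sin q.2) (by fun_prop)
    (fun _ => Real.abs_sin_le_one _) ha)

/-- Only the sum is preserved: at each point the pair $(a,b)$ is rotated, which keeps $a^2+b^2$. -/
theorem eLpNorm_rotation (ha : MemLp a 2 μ) (hb : MemLp b 2 μ) :
    (eLpNorm (fun q => Real.cos q.2 * a q + Real.sin q.2 * b q) 2 μ).toReal ^ 2 +
      (eLpNorm (fun q => Real.cos q.2 * b q - Real.sin q.2 * a q) 2 μ).toReal ^ 2 =
    (eLpNorm a 2 μ).toReal ^ 2 + (eLpNorm b 2 μ).toReal ^ 2 := by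
  have h1 := memLp_cos_add_sin ha hb
  have h2 := memLp_cos_sub_sin ha hb
  rw [toReal_eLpNorm_sq h1, toReal_eLpNorm_sq h2, toReal_eLpNorm_sq ha, toReal_eLpNorm_sq hb,
    ← integral_add h1.integrable_sq h2.integrable_sq,
    ← integral_add ha.integrable_sq hb.integrable_sq]
  refine integral_congr_ae (Filter.Eventually.of_forall fun q => ?_)
  linear_combination (a q ^ 2 + b q ^ 2) * Real.cos_sq_add_sin_sq q.2

end Rotation

/-! ### The pullback along the polar map -/

section Pullback

variable {Θ : ℝ}

/-- The pullback `u ↦ u ∘ F` as an isometry from `L²(Ω)` into `L²_r(Q)`. -/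
noncomputable def polarPullback (hΘ : Θ ≤ 2 * Real.pi) :
    Lp ℝ 2 (volume.restrict (sector Θ : Set (ℝ × ℝ))) →ₗᵢ[ℝ] Lp ℝ 2 (measR Θ) :=
  Lp.compMeasurePreservingₗᵢ ℝ polarMap (measurePreserving_polarMap hΘ)

theorem coeFn_polarPullback (hΘ : Θ ≤ 2 * Real.pi)
    (u : Lp ℝ 2 (volume.restrict (sector Θ : Set (ℝ × ℝ)))) :
    polarPullback hΘ u =ᵐ[measR Θ] u ∘ polarMap :=
  Lp.coeFn_compMeasurePreserving u (measurePreserving_polarMap hΘ)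

/-- This is independence of the representative: preimages of null sets under $F$ are null for
$r\,dr\,d\theta$, hence for Lebesgue measure on $Q$. -/
theorem polarPullback_ae_eq (hΘ : Θ ≤ 2 * Real.pi)
    {u : Lp ℝ 2 (volume.restrict (sector Θ : Set (ℝ × ℝ)))} {f : ℝ × ℝ → ℝ}
    (hf : u =ᵐ[volume.restrict (sector Θ : Set (ℝ × ℝ))] f) :
    polarPullback hΘ u =ᵐ[volume.restrict (rect Θ : Set (ℝ × ℝ))] f ∘ polarMap :=
  (SameNullSets.ca (U := rect Θ)).ae_eq ((coeFn_polarPullback hΘ u).trans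
    ((measurePreserving_polarMap hΘ).quasiMeasurePreserving.ae_eq hf))

theorem exists_polarPullback (hΘ : Θ ≤ 2 * Real.pi) (u : H1 (sector Θ)) :
    ∃ v : HTilde Θ, v.toL2 = polarPullback hΘ u.toL2 ∧ ‖v‖ = ‖u‖ := by
  have hmp := measurePreserving_polarMap hΘ
  have hm : ∀ f : Lp ℝ 2 (volume.restrict (sector Θ : Set (ℝ × ℝ))),
      MemLp (f ∘ polarMap) 2 (measR Θ) := fun f => (Lp.memLp f).comp_measurePreserving hmp
  have hn : ∀ f : Lp ℝ 2 (volume.restrict (sector Θ : Set (ℝ × ℝ))),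
      (eLpNorm (f ∘ polarMap) 2 (measR Θ)).toReal = ‖f‖ := fun f => by
    rw [eLpNorm_comp_measurePreserving (Lp.aestronglyMeasurable f) hmp, Lp.norm_def]
  have m₁ := memLp_cos_add_sin (hm u.d₁) (hm u.d₂)
  have m₂ := memLp_cos_sub_sin (hm u.d₁) (hm u.d₂)
  -- The angular derivative carries a factor $r$, which the passage from $L^2_{1/r}$ to $L^2_r$
  -- divides out.
  have hθ : (fun q : ℝ × ℝ => q.1⁻¹ * (q.1 * (Real.cos q.2 * (u.d₂ ∘ polarMap) q -
      Real.sin q.2 * (u.d₁ ∘ polarMap) q))) =ᵐ[measR Θ]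
      fun q => Real.cos q.2 * (u.d₂ ∘ polarMap) q - Real.sin q.2 * (u.d₁ ∘ polarMap) q := by
    filter_upwards [ae_measR_mem Θ] with q hq
    rw [inv_mul_cancel_left₀ hq.1.1.ne']
  have m₂' := memLp_measRInv_iff.2 (m₂.ae_eq hθ.symm)
  obtain ⟨v, hv, hv₁, hv₂⟩ := WSobolev.exists_of_hasWeakPartial (U := rect Θ)
    (polarPullback hΘ u.toL2) (coeFn_polarPullback hΘ u.toL2) m₁ m₂'
    (u.hasWeakPartial_d₁.radial hΘ u.hasWeakPartial_d₂
      (locallyIntegrableOn_of_memLp_measR (hm u.toL2)) (locallyIntegrableOn_of_memLp_measR m₁)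
      fun _ _ => rfl)
    (u.hasWeakPartial_d₁.angular hΘ u.hasWeakPartial_d₂
      (locallyIntegrableOn_of_memLp_measR (hm u.toL2))
      (locallyIntegrableOn_of_memLp_measRInv m₂') fun _ _ => rfl)
  refine ⟨v, hv, ?_⟩
  rw [← sq_eq_sq₀ (norm_nonneg _) (norm_nonneg _), WSobolev.norm_sq_eq, WSobolev.norm_sq_eq,
    hv, LinearIsometry.norm_map, add_assoc, add_assoc, Lp.norm_def v.d₁, Lp.norm_def v.d₂,
    eLpNorm_congr_ae hv₁, eLpNorm_congr_ae hv₂, eLpNorm_measRInv, eLpNorm_congr_ae hθ,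
    eLpNorm_rotation (hm u.d₁) (hm u.d₂), hn, hn]

theorem exists_polarPullback_eq (hΘ : Θ ≤ 2 * Real.pi) (v : HTilde Θ) :
    ∃ u : H1 (sector Θ), polarPullback hΘ u.toL2 = v.toL2 := by
  have hmp := measurePreserving_polarInv hΘ
  have hm : ∀ {f : ℝ × ℝ → ℝ}, MemLp f 2 (measR Θ) →
      MemLp (f ∘ polarInv) 2 (volume.restrict (sector Θ : Set (ℝ × ℝ))) := fun hf =>
    hf.comp_measurePreserving hmp
  have hθ := memLp_measRInv_iff.1 (Lp.memLp v.d₂)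
  have hr := Lp.memLp v.d₁
  -- The rotation lemmas are used with $a=r^{-1}\partial_\theta v$ and $b=\partial_rv$; this order
  -- produces the inverse rotation, back to Cartesian components.
  have m₁ := hm (memLp_cos_sub_sin hθ hr)
  have m₂ : MemLp ((fun q => Real.sin q.2 * v.d₁ q + Real.cos q.2 * (q.1⁻¹ * v.d₂ q)) ∘ polarInv)
      2 (volume.restrict (sector Θ : Set (ℝ × ℝ))) := by
    simpa only [add_comm] using hm (memLp_cos_add_sin hθ hr)
  have m₀ := hm (Lp.memLp v.toL2)
  obtain ⟨u, hu, -, -⟩ := WSobolev.exists_of_hasWeakPartial (U := sector Θ)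
    (m₀.toLp _) m₀.coeFn_toLp m₁ m₂
    (v.hasWeakPartial_d₁.comp_polarInv_fst hΘ v.hasWeakPartial_d₂
      (locallyIntegrableOn_of_memLp_restrict m₀) (locallyIntegrableOn_of_memLp_restrict m₁)
      fun _ _ => rfl)
    (v.hasWeakPartial_d₁.comp_polarInv_snd hΘ v.hasWeakPartial_d₂
      (locallyIntegrableOn_of_memLp_restrict m₀) (locallyIntegrableOn_of_memLp_restrict m₂)
      fun _ _ => rfl)
  refine ⟨u, Lp.ext ?_⟩
  rw [hu]
  filter_upwards [ae_restrict_iff_measR.2 (polarPullback_ae_eq hΘ m₀.coeFn_toLp),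
    ae_measR_mem Θ] with q hq hqQ
  rw [hq, Function.comp_apply, Function.comp_apply, polarInv_polarMap hΘ hqQ]

/-- The pullback `u ↦ u ∘ F` as an isometry from `H¹(Ω)` onto `H̃¹(Q)`. -/
noncomputable def polarPullbackSobolev (hΘ : Θ ≤ 2 * Real.pi) :
    H1 (sector Θ) ≃ₗᵢ[ℝ] HTilde Θ :=
  LinearIsometryEquiv.ofSurjective
    { toFun := fun u => (exists_polarPullback hΘ u).choose
      -- A Sobolev element is determined by its $L^2$ class, so linearity is inherited from the
      -- $L^2$ pullback despite the choice.
      map_add' := fun u v => WSobolev.toL2_injective <| by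
        rw [(exists_polarPullback hΘ (u + v)).choose_spec.1, map_add, map_add, map_add,
          (exists_polarPullback hΘ u).choose_spec.1, (exists_polarPullback hΘ v).choose_spec.1]
      map_smul' := fun c u => WSobolev.toL2_injective <| by
        rw [(exists_polarPullback hΘ (c • u)).choose_spec.1, map_smul, map_smul, map_smul,
          (exists_polarPullback hΘ u).choose_spec.1, RingHom.id_apply]
      norm_map' := fun u => (exists_polarPullback hΘ u).choose_spec.2 }
    fun v => by
      obtain ⟨u, hu⟩ := exists_polarPullback_eq hΘ v
      exact ⟨u, WSobolev.toL2_injective ((exists_polarPullback hΘ u).choose_spec.1.trans hu)⟩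

theorem toL2_polarPullbackSobolev (hΘ : Θ ≤ 2 * Real.pi) (u : H1 (sector Θ)) :
    (polarPullbackSobolev hΘ u).toL2 = polarPullback hΘ u.toL2 :=
  (exists_polarPullback hΘ u).choose_spec.1

end Pullback

end PolarSobolev

open PolarSobolev in
theorem mainTheorem3 (Θ : ℝ) (hΘ : Θ ∈ Ioo 0 (2 * Real.pi)) :
    ∃ Φ : Lp ℝ 2 (volume.restrict (sector Θ : Set (ℝ × ℝ))) →ₗ[ℝ] Lp ℝ 2 (measR Θ),
      (∀ (u : Lp ℝ 2 (volume.restrict (sector Θ : Set (ℝ × ℝ)))) (f : ℝ × ℝ → ℝ),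
        u =ᵐ[volume.restrict (sector Θ : Set (ℝ × ℝ))] f →
          Φ u =ᵐ[volume.restrict (rect Θ : Set (ℝ × ℝ))] f ∘ polarMap) ∧
      ∃ Ψ : H1 (sector Θ) ≃ₗᵢ[ℝ] HTilde Θ, ∀ u : H1 (sector Θ), (Ψ u).toL2 = Φ u.toL2 :=
  ⟨(polarPullback hΘ.2.le).toLinearMap, fun _ _ hf => polarPullback_ae_eq hΘ.2.le hf,
    polarPullbackSobolev hΘ.2.le, toL2_polarPullbackSobolev hΘ.2.le⟩
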